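/- **Conventions.** A vertex operator algebra (VOA) $V$ over $\mathbb C$, with vacuum $\mathbf 1\neq 0$, Virasoro vector $\omega\ne 0$, modes $Y(v,z)=\sum_{n\in\mathbb Z} v_{(n)}z^{-n-1}$ and $L_n=\omega_{(n+1)}$, is graded by $L_0$-eigenspaces, $V=\bigoplus_{n\ge 0}V_n$, with $\dim V_n<\infty$ and $V_0=\mathbb C\mathbf 1$. It is assumed that $V=\bigoplus_i M_i$ is a direct sum of highest weight modules for the Virasoro algebra (nonzero quotients of Verma modules $M(c,h_i)$) with $h_i\in\mathbb Z_{\ge 0}$. Let $\overline M(h)$ be the sum of the $M_i$ with $h_i=h$; then $\overline M(0)=V_\omega$ is the subVOA generated by $\omega$. Let $\pi:V\to V_\omega$ be the projection with kernel $\bigoplus_{h>0}\overline M(h)$; it is assumed to be natural, i.e. independent of the choice of the decomposition. The minimal conformal weight of such a VOA is the smallest $h>0$ with $\overline M(h)\ne 0$ ($\infty$ if there is none). A module $N$ of $V$ is an ordinary module: $N=\bigoplus_{h\in\mathbb C}N_h$ with finite-dimensional $L_0$-eigenspaces $N_h$, and, for each $h$, $N_{h-n}=0$ for all large integers $n$.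 Its homogeneous subspaces are the $N_h$. For $v\in V_n$ put $\mathrm o(v)=v_{(n-1)}$, which maps each $N_h$ to itself. The space $X=N_h$ is a *conformal $t$-design* if $\operatorname{tr}|_X\,\mathrm o(v)=\operatorname{tr}|_X\,\mathrm o(\pi(v))$ for all $v\in V_n$ and all $0\le n\le t$. Let $G$ be a compact Lie group acting on $V$ by VOA automorphisms (fixing $\mathbf 1$ and $\omega$), continuously on each $V_n$. A $V$-module $N$ is *$G$-invariant* if there is a central extension $\widehat G$ of $G$ acting linearly on $N$ such that $g^{-1}\,Y_N(\bar g v,z)\,g=Y_N(v,z)$ for all $g\in\widehat G$ with image $\bar g\in G$ and all $v\in V$. **Theorem 2.2.** Let $V$ be a VOA and let $G$ be a compact Lie group of automorphisms of $V$, as above. Let $X=N_h$ be a homogeneous subspace of a $G$-invariant $V$-module $N$. If the fixed-point VOA $V^G$, also assumed to be a direct sum of highest weight modules for the Virasoro algebra as above, has minimal conformal weight at least $t+1$, then $X$ is a conformal $t$-design. -/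

import Mathlib

open scoped Manifold ContDiff

universe u v w x

noncomputable section

/-- A vertex operator algebra over `ℂ` on the vector space `V`.  The map `Y` sends `v` to
`Y(v, z) = ∑ v₍ₙ₎ z⁻ⁿ⁻¹`; here `v₍ₙ₎` is `VertexOperator.ncoeff (Y v) n`, and values in Laurent
series encode the truncation condition `v₍ₙ₎ w = 0` for `n ≫ 0`. -/
structure VOA (V : Type u) [AddCommGroup V] [Module ℂ V] where
  /-- the state-field correspondence -/
  Y : V →ₗ[ℂ] VertexOperator ℂ V
  /-- the vacuum vector -/
  vac : V
  /-- the Virasoro vector `ω` -/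
  vir : V
  /-- the central charge -/
  c : ℂ
  vac_ne_zero : vac ≠ 0
  vir_ne_zero : vir ≠ 0
  /-- the vacuum acts as the identity -/
  vac_mode : ∀ n : ℤ, VertexOperator.ncoeff (Y vac) n = if n = -1 then 1 else 0
  /-- `Y(v, z) 𝟏` has no pole, and constant term `v` -/
  creation : ∀ (v : V), VertexOperator.ncoeff (Y v) (-1) vac = v ∧
    ∀ n : ℤ, 0 ≤ n → VertexOperator.ncoeff (Y v) n vac = 0
  /-- the Borcherds (Jacobi) identity in components; all the sums are finite by truncation -/
  borcherds : ∀ (a b x : V) (m n k : ℤ),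
    ∑ᶠ i : ℕ, ((Ring.choose m i : ℤ) : ℂ) •
      VertexOperator.ncoeff (Y (VertexOperator.ncoeff (Y a) (n + i) b)) (m + k - i) x =
    ∑ᶠ i : ℕ, ((-1 : ℂ) ^ i * ((Ring.choose n i : ℤ) : ℂ)) •
      (VertexOperator.ncoeff (Y a) (m + n - i) (VertexOperator.ncoeff (Y b) (k + i) x) -
        (-1 : ℂ) ^ n •
          VertexOperator.ncoeff (Y b) (n + k - i) (VertexOperator.ncoeff (Y a) (m + i) x))
  /-- the operators `Lₙ = ω₍ₙ₊₁₎` satisfy the Virasoro relations with central charge `c` -/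
  virasoro : ∀ m n : ℤ,
    ⁅VertexOperator.ncoeff (Y vir) (m + 1), VertexOperator.ncoeff (Y vir) (n + 1)⁆ =
      ((m : ℂ) - n) • VertexOperator.ncoeff (Y vir) (m + n + 1) +
        (if m + n = 0 then ((m : ℂ) ^ 3 - m) / 12 * c else 0) • (1 : Module.End ℂ V)
  /-- `Y(L₋₁ v, z) = d/dz Y(v, z)` -/
  derivative : ∀ (v : V) (n : ℤ),
    VertexOperator.ncoeff (Y (VertexOperator.ncoeff (Y vir) 0 v)) n =
      (-n : ℂ) • VertexOperator.ncoeff (Y v) (n - 1)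
  /-- `V` is the sum (automatically direct) of the eigenspaces `Vₙ`, `n = 0, 1, 2, …`, of `L₀` -/
  grading : ⨆ n : ℕ, Module.End.eigenspace (VertexOperator.ncoeff (Y vir) 1) (n : ℂ) = ⊤
  finite_dim : ∀ n : ℕ,
    FiniteDimensional ℂ (Module.End.eigenspace (VertexOperator.ncoeff (Y vir) 1) (n : ℂ))
  /-- `V₀ = ℂ 𝟏` -/
  degree_zero : Module.End.eigenspace (VertexOperator.ncoeff (Y vir) 1) 0 = Submodule.span ℂ {vac}

namespace VOA

variable {V : Type u} [AddCommGroup V] [Module ℂ V]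

/-- The mode `v₍ₙ₎`. -/
def mode (𝒱 : VOA V) (v : V) (n : ℤ) : Module.End ℂ V := VertexOperator.ncoeff (𝒱.Y v) n

/-- The Virasoro operator `Lₙ = ω₍ₙ₊₁₎`. -/
def L (𝒱 : VOA V) (n : ℤ) : Module.End ℂ V := 𝒱.mode 𝒱.vir (n + 1)

/-- The homogeneous subspace `Vₙ` of degree `n`. -/
def degree (𝒱 : VOA V) (n : ℕ) : Submodule ℂ V := Module.End.eigenspace (𝒱.L 0) (n : ℂ)

theorem mem_degree (𝒱 : VOA V) {n : ℕ} {v : V} :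
    v ∈ 𝒱.degree n ↔ 𝒱.L 0 v = (n : ℂ) • v := Module.End.mem_eigenspace_iff

/-! ### Decompositions into highest weight modules for the Virasoro algebra -/

/-- The Virasoro submodule of `V` generated by the vector `v`. -/
def virasoroSpan (𝒱 : VOA V) (v : V) : Submodule ℂ V :=
  sInf {W | v ∈ W ∧ ∀ (n : ℤ), ∀ x ∈ W, 𝒱.L n x ∈ W}

theorem L_mem_virasoroSpan (𝒱 : VOA V) (v : V) (n : ℤ) {x : V} (hx : x ∈ 𝒱.virasoroSpan v) :
    𝒱.L n x ∈ 𝒱.virasoroSpan v := by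
  simp only [virasoroSpan, Submodule.mem_sInf, Set.mem_ofPred_eq] at hx ⊢
  exact fun W hW => hW.2 n x (hx W hW)

/-- `v` is a Virasoro highest weight vector of weight `h`. -/
def IsHighestWeight (𝒱 : VOA V) (h : ℕ) (v : V) : Prop :=
  v ≠ 0 ∧ v ∈ 𝒱.degree h ∧ ∀ n : ℤ, 1 ≤ n → 𝒱.L n v = 0

/-- A decomposition `V = ⨁ Mᵢ` into highest weight modules for the Virasoro algebra, with highest
weights in `ℤ_{≥ 0}`.  A (nonzero) quotient of the Verma module `M(c, h)` is the same thing as a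
module of central charge `c` generated by a highest weight vector of weight `h`, so the
decomposition is recorded by a set of highest weight vectors, one for each summand. -/
structure Decomposition (𝒱 : VOA V) where
  gens : Set V
  highest : ∀ v ∈ gens, ∃ h : ℕ, 𝒱.IsHighestWeight h v
  independent : iSupIndep (fun v : gens => 𝒱.virasoroSpan v)
  total : ⨆ v : gens, 𝒱.virasoroSpan v = ⊤

namespace Decomposition

variable {𝒱 : VOA V}

/-- `M̄(h)`: the sum of the summands with highest weight `h`. -/
def isotypic (D : Decomposition 𝒱) (h : ℕ) : Submodule ℂ V :=
  ⨆ v ∈ {v : D.gens | (v : V) ∈ 𝒱.degree h}, 𝒱.virasoroSpan v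

/-- `⨁_{h > 0} M̄(h)`. -/
def positive (D : Decomposition 𝒱) : Submodule ℂ V := ⨆ (h : ℕ) (_ : 0 < h), D.isotypic h

theorem degree_unique {v : V} (hv : v ≠ 0) {h k : ℕ} (h1 : v ∈ 𝒱.degree h)
    (h2 : v ∈ 𝒱.degree k) : h = k := by
  rw [mem_degree] at h1 h2
  have : ((h : ℂ) - k) • v = 0 := by rw [sub_smul, ← h1, ← h2, sub_self]
  rcases smul_eq_zero.1 this with h3 | h3
  · exact_mod_cast sub_eq_zero.1 h3
  · exact absurd h3 hv

theorem positive_eq (D : Decomposition 𝒱) :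
    D.positive = ⨆ v ∈ {v : D.gens | (v : V) ∈ 𝒱.degree 0}ᶜ, 𝒱.virasoroSpan v := by
  apply le_antisymm
  · refine iSup₂_le fun h hh => iSup₂_le fun v hv => ?_
    refine le_iSup₂_of_le (f := fun (v : D.gens) _ => 𝒱.virasoroSpan (v : V)) v ?_ le_rfl
    intro h0
    obtain ⟨k, hk⟩ := D.highest v v.2
    exact hh.ne (degree_unique hk.1 h0 hv)
  · refine iSup₂_le fun v hv => ?_
    obtain ⟨k, hk⟩ := D.highest v v.2
    have hk0 : 0 < k := by
      rcases Nat.eq_zero_or_pos k with rfl | h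
      · exact absurd hk.2.1 hv
      · exact h
    exact le_trans (le_iSup₂_of_le (f := fun (v : D.gens)
      (_ : v ∈ {v : D.gens | (v : V) ∈ 𝒱.degree k}) => 𝒱.virasoroSpan (v : V)) v hk.2.1 le_rfl)
      (le_iSup₂_of_le (f := fun (h : ℕ) (_ : 0 < h) => D.isotypic h) k hk0 le_rfl)

theorem isCompl (D : Decomposition 𝒱) : IsCompl (D.isotypic 0) D.positive := by
  rw [positive_eq]
  refine ⟨D.independent.disjoint_biSup_biSup disjoint_compl_right, ?_⟩
  rw [codisjoint_iff, eq_top_iff, ← D.total]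
  refine iSup_le fun v => ?_
  by_cases hv : v ∈ {v : D.gens | (v : V) ∈ 𝒱.degree 0}
  · exact le_sup_of_le_left (le_iSup₂_of_le (f := fun (v : D.gens)
      (_ : v ∈ {v : D.gens | (v : V) ∈ 𝒱.degree 0}) => 𝒱.virasoroSpan (v : V)) v hv le_rfl)
  · exact le_sup_of_le_right (le_iSup₂_of_le (f := fun (v : D.gens)
      (_ : v ∈ {v : D.gens | (v : V) ∈ 𝒱.degree 0}ᶜ) => 𝒱.virasoroSpan (v : V)) v hv le_rfl)

/-- The projection `π` of `V = M̄(0) ⊕ ⨁_{h > 0} M̄(h)` onto `M̄(0)` with kernel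
`⨁_{h > 0} M̄(h)`.  (As `V₀ = ℂ 𝟏`, `M̄(0)` is the Virasoro submodule generated by `𝟏`, which is the
vertex operator subalgebra generated by `ω`.) -/
def π (D : Decomposition 𝒱) : V →ₗ[ℂ] V := Submodule.projection _ _ D.isCompl

theorem L_mem_isotypic (D : Decomposition 𝒱) (h : ℕ) (n : ℤ) {x : V} (hx : x ∈ D.isotypic h) :
    𝒱.L n x ∈ D.isotypic h := by
  suffices H : D.isotypic h ≤ (D.isotypic h).comap (𝒱.L n) from H hx
  exact iSup₂_le fun v hv x hx => le_iSup₂_of_le (f := fun (v : D.gens)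
    (_ : v ∈ {v : D.gens | (v : V) ∈ 𝒱.degree h}) => 𝒱.virasoroSpan (v : V)) v hv le_rfl
    (𝒱.L_mem_virasoroSpan v n hx)

theorem L_mem_positive (D : Decomposition 𝒱) (n : ℤ) {x : V} (hx : x ∈ D.positive) :
    𝒱.L n x ∈ D.positive := by
  suffices H : D.positive ≤ D.positive.comap (𝒱.L n) from H hx
  exact iSup₂_le fun h hh x hx => le_iSup₂_of_le
    (f := fun (h : ℕ) (_ : 0 < h) => D.isotypic h) h hh le_rfl (D.L_mem_isotypic h n hx)

/-- `π` preserves degrees. -/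
theorem π_mem_degree (D : Decomposition 𝒱) {n : ℕ} {v : V} (hv : v ∈ 𝒱.degree n) :
    D.π v ∈ 𝒱.degree n := by
  rw [mem_degree] at hv ⊢
  have h1 : D.π v ∈ D.isotypic 0 := Submodule.projection_apply_mem D.isCompl v
  have h2 : v - D.π v ∈ D.positive := by
    have : D.π (v - D.π v) = 0 := by
      rw [map_sub, sub_eq_zero]
      exact (Submodule.projection_apply_left D.isCompl ⟨_, h1⟩).symm
    rw [← Submodule.ker_projection D.isCompl]
    exact this
  have h3 : 𝒱.L 0 (D.π v) - (n : ℂ) • D.π v ∈ D.isotypic 0 :=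
    sub_mem (D.L_mem_isotypic 0 0 h1) (Submodule.smul_mem _ _ h1)
  have h4 : 𝒱.L 0 (D.π v) - (n : ℂ) • D.π v ∈ D.positive := by
    have : 𝒱.L 0 (D.π v) - (n : ℂ) • D.π v =
        (n : ℂ) • (v - D.π v) - 𝒱.L 0 (v - D.π v) := by
      rw [map_sub, hv, smul_sub]; abel
    rw [this]
    exact sub_mem (Submodule.smul_mem _ _ h2) (D.L_mem_positive 0 h2)
  exact sub_eq_zero.1 (Submodule.disjoint_def.1 D.isCompl.disjoint _ h3 h4)

/-- The minimal (conformal) weight: the smallest `h > 0` with `M̄(h) ≠ 0`, and `∞` if there is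
none. -/
def minimalWeight (D : Decomposition 𝒱) : ℕ∞ :=
  ⨅ (h : ℕ) (_ : 0 < h ∧ D.isotypic h ≠ ⊥), (h : ℕ∞)

/-- The projection `π` is natural: it does not depend on the choice of the decomposition. -/
def IsNatural (D : Decomposition 𝒱) : Prop := ∀ D' : Decomposition 𝒱, D'.π = D.π

end Decomposition

/-! ### Automorphisms and fixed points -/

/-- The automorphism group of a vertex operator algebra, as a subgroup of `GL(V)`. -/
def aut (𝒱 : VOA V) : Subgroup (V ≃ₗ[ℂ] V) where
  carrier := {g | g 𝒱.vac = 𝒱.vac ∧ g 𝒱.vir = 𝒱.vir ∧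
    ∀ (v x : V) (n : ℤ), g (𝒱.mode v n x) = 𝒱.mode (g v) n (g x)}
  one_mem' := ⟨rfl, rfl, fun _ _ _ => rfl⟩
  mul_mem' := by
    rintro a b ⟨ha1, ha2, ha3⟩ ⟨hb1, hb2, hb3⟩
    simp only [Set.mem_ofPred_eq, LinearEquiv.mul_apply]
    exact ⟨by rw [hb1, ha1], by rw [hb2, ha2], fun v x n => by rw [hb3, ha3]⟩
  inv_mem' := by
    rintro a ⟨ha1, ha2, ha3⟩
    have key : ∀ x y : V, a x = y → a⁻¹ y = x := fun x y h => by
      rw [← h]; exact a.symm_apply_apply x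
    have key' : ∀ x : V, a (a⁻¹ x) = x := fun x => a.apply_symm_apply x
    exact ⟨key _ _ ha1, key _ _ ha2, fun v x n => key _ _ (by rw [ha3, key', key'])⟩

variable {G : Type w} [Group G]

/-- The subspace `V^G` of `G`-fixed vectors. -/
def fixedSpace (𝒱 : VOA V) (ρ : G →* 𝒱.aut) : Submodule ℂ V where
  carrier := {v | ∀ g : G, (ρ g : V ≃ₗ[ℂ] V) v = v}
  zero_mem' := fun _ => map_zero _
  add_mem' := fun ha hb g => by rw [map_add, ha g, hb g]
  smul_mem' := fun c v hv g => by rw [map_smul, hv g]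

section fixed

variable {𝒱 : VOA V} (ρ : G →* 𝒱.aut)

theorem vac_mem_fixedSpace : 𝒱.vac ∈ 𝒱.fixedSpace ρ := fun g => (ρ g).2.1

theorem vir_mem_fixedSpace : 𝒱.vir ∈ 𝒱.fixedSpace ρ := fun g => (ρ g).2.2.1

theorem mode_mem_fixedSpace {v x : V} (hv : v ∈ 𝒱.fixedSpace ρ) (n : ℤ)
    (hx : x ∈ 𝒱.fixedSpace ρ) : 𝒱.mode v n x ∈ 𝒱.fixedSpace ρ :=
  fun g => by rw [(ρ g).2.2.2, hv g, hx g]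

/-- The modes of elements of `V^G`, restricted to `V^G`. -/
def fixedMode (v : 𝒱.fixedSpace ρ) (n : ℤ) : Module.End ℂ (𝒱.fixedSpace ρ) :=
  (𝒱.mode v n).restrict fun _ hx => mode_mem_fixedSpace ρ v.2 n hx

theorem coe_fixedMode (v : 𝒱.fixedSpace ρ) (n : ℤ) (x : 𝒱.fixedSpace ρ) :
    (fixedMode ρ v n x : V) = 𝒱.mode v n x := rfl

theorem fixedMode_bddBelow (v x : 𝒱.fixedSpace ρ) :
    BddBelow (Function.support fun n : ℤ => fixedMode ρ v (-n - 1) x) := by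
  refine ⟨((HahnModule.of ℂ).symm (𝒱.Y v x)).order, fun n hn => ?_⟩
  by_contra hlt
  apply hn
  apply Subtype.ext
  rw [coe_fixedMode]
  exact VertexOperator.ncoeff_eq_zero_of_lt_order _ _ _ (by simpa using not_le.1 hlt)

/-- The vertex operators of `V^G`. -/
def fixedY : 𝒱.fixedSpace ρ →ₗ[ℂ] VertexOperator ℂ (𝒱.fixedSpace ρ) where
  toFun v := VertexOperator.of_coeff (fun n => fixedMode ρ v (-n - 1)) fun x => fixedMode_bddBelow ρ v x
  map_add' u v := by
    apply HVertexOperator.coeff_inj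
    funext n
    apply LinearMap.ext
    intro x
    apply Subtype.ext
    change 𝒱.mode ((u : V) + v) (-n - 1) x = 𝒱.mode u (-n - 1) x + 𝒱.mode v (-n - 1) x
    simp [mode]
  map_smul' r v := by
    apply HVertexOperator.coeff_inj
    funext n
    apply LinearMap.ext
    intro x
    apply Subtype.ext
    change 𝒱.mode (r • (v : V)) (-n - 1) x = r • 𝒱.mode v (-n - 1) x
    simp [mode]

theorem ncoeff_fixedY (v : 𝒱.fixedSpace ρ) (n : ℤ) :
    VertexOperator.ncoeff (fixedY ρ v) n = fixedMode ρ v n := by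
  change VertexOperator.ncoeff (VertexOperator.of_coeff (fun n => fixedMode ρ v (-n - 1))
    fun x => fixedMode_bddBelow ρ v x) n = _
  rw [VertexOperator.ncoeff_of_coeff]
  congr 1
  ring

theorem coe_ncoeff_fixedY (v x : 𝒱.fixedSpace ρ) (n : ℤ) :
    (VertexOperator.ncoeff (fixedY ρ v) n x : V) = VertexOperator.ncoeff (𝒱.Y v) n x := by
  rw [ncoeff_fixedY]; rfl

theorem mem_fixed_eigenspace (x : 𝒱.fixedSpace ρ) (μ : ℂ) :
    x ∈ Module.End.eigenspace
      (VertexOperator.ncoeff (fixedY ρ ⟨𝒱.vir, vir_mem_fixedSpace ρ⟩) 1) μ ↔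
    (x : V) ∈ Module.End.eigenspace (VertexOperator.ncoeff (𝒱.Y 𝒱.vir) 1) μ := by
  rw [Module.End.mem_eigenspace_iff, Module.End.mem_eigenspace_iff, ← Subtype.coe_inj,
    coe_ncoeff_fixedY]
  rfl

theorem fixed_grading : ⨆ n : ℕ, Module.End.eigenspace
    (VertexOperator.ncoeff (fixedY ρ ⟨𝒱.vir, vir_mem_fixedSpace ρ⟩) 1) (n : ℂ) = ⊤ := by
  rw [eq_top_iff]
  rintro ⟨x, hx⟩ -
  have hx' : x ∈ ⨆ n : ℕ, Module.End.eigenspace (VertexOperator.ncoeff (𝒱.Y 𝒱.vir) 1) (n : ℂ) := by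
    rw [𝒱.grading]; trivial
  obtain ⟨f, hf, hsum⟩ := (Submodule.mem_iSup_iff_exists_finsupp _ _).1 hx'
  have hind : iSupIndep fun n : ℕ =>
      Module.End.eigenspace (VertexOperator.ncoeff (𝒱.Y 𝒱.vir) 1) (n : ℂ) :=
    (Module.End.eigenspaces_iSupIndep _).comp Nat.cast_injective
  have hfix : ∀ n, f n ∈ 𝒱.fixedSpace ρ := by
    intro n g
    have hg : ∀ n : ℕ, (ρ g : V ≃ₗ[ℂ] V) (f n) ∈
        Module.End.eigenspace (VertexOperator.ncoeff (𝒱.Y 𝒱.vir) 1) (n : ℂ) := by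
      intro n
      rw [Module.End.mem_eigenspace_iff]
      have h1 := (ρ g).2.2.2 𝒱.vir (f n) 1
      rw [(ρ g).2.2.1] at h1
      have h2 := Module.End.mem_eigenspace_iff.1 (hf n)
      change 𝒱.mode 𝒱.vir 1 _ = _
      change 𝒱.mode 𝒱.vir 1 _ = _ at h2
      rw [← h1, h2, map_smul]
    have h0 : ∑ i ∈ f.support, ((ρ g : V ≃ₗ[ℂ] V) (f i) - f i) = 0 := by
      rw [Finset.sum_sub_distrib, ← map_sum]
      change (ρ g : V ≃ₗ[ℂ] V) (f.sum fun _ x => x) - (f.sum fun _ x => x) = 0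
      rw [hsum, hx g, sub_self]
    by_cases hn : n ∈ f.support
    · exact sub_eq_zero.1 ((iSupIndep_iff_finsetSum_eq_zero_imp_eq_zero _).1 hind f.support _
        (fun i _ => sub_mem (hg i) (hf i)) h0 n hn)
    · rw [Finsupp.notMem_support_iff.1 hn, map_zero]
  have hx2 : (⟨x, hx⟩ : 𝒱.fixedSpace ρ) = ∑ i ∈ f.support, ⟨f i, hfix i⟩ := by
    apply Subtype.ext
    rw [AddSubmonoidClass.coe_finsetSum]
    exact hsum.symm
  rw [hx2]
  exact Submodule.sum_mem _ fun i _ => Submodule.mem_iSup_of_mem i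
    ((mem_fixed_eigenspace ρ _ _).2 (hf i))

/-- The fixed-point vertex operator algebra `V^G`: the operations of `V`, restricted. -/
def fixed : VOA (𝒱.fixedSpace ρ) where
  Y := fixedY ρ
  vac := ⟨𝒱.vac, vac_mem_fixedSpace ρ⟩
  vir := ⟨𝒱.vir, vir_mem_fixedSpace ρ⟩
  c := 𝒱.c
  vac_ne_zero := fun h => 𝒱.vac_ne_zero (congrArg Subtype.val h)
  vir_ne_zero := fun h => 𝒱.vir_ne_zero (congrArg Subtype.val h)
  vac_mode n := by
    apply LinearMap.ext
    intro x
    apply Subtype.ext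
    rw [coe_ncoeff_fixedY, 𝒱.vac_mode]
    split_ifs <;> rfl
  creation v := by
    refine ⟨Subtype.ext ?_, fun n hn => Subtype.ext ?_⟩
    · rw [coe_ncoeff_fixedY]; exact (𝒱.creation v).1
    · rw [coe_ncoeff_fixedY]; exact (𝒱.creation v).2 n hn
  borcherds a b x m n k := by
    apply Subtype.ext
    have key : ∀ f : ℕ → 𝒱.fixedSpace ρ, ((∑ᶠ i, f i : 𝒱.fixedSpace ρ) : V) = ∑ᶠ i, (f i : V) :=
      fun f => (𝒱.fixedSpace ρ).subtype.toAddMonoidHom.map_finsum_of_injective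
        Subtype.val_injective f
    rw [key, key]
    simp only [Submodule.coe_smul, Submodule.coe_sub, coe_ncoeff_fixedY]
    exact 𝒱.borcherds a b x m n k
  virasoro m n := by
    apply LinearMap.ext
    intro x
    apply Subtype.ext
    have := LinearMap.congr_fun (𝒱.virasoro m n) x
    simp only [Ring.lie_def, LinearMap.sub_apply, Module.End.mul_apply, LinearMap.add_apply,
      LinearMap.smul_apply, Module.End.one_apply, Submodule.coe_smul, Submodule.coe_sub,
      Submodule.coe_add, coe_ncoeff_fixedY] at this ⊢
    exact this
  derivative v n := by
    apply LinearMap.ext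
    intro x
    apply Subtype.ext
    have := LinearMap.congr_fun (𝒱.derivative v n) x
    simp only [LinearMap.smul_apply, Submodule.coe_smul, coe_ncoeff_fixedY] at this ⊢
    exact this
  grading := fixed_grading ρ
  finite_dim n := by
    have := 𝒱.finite_dim n
    refine Module.Finite.of_injective
      (((𝒱.fixedSpace ρ).subtype.comp (Submodule.subtype _)).codRestrict
        (Module.End.eigenspace (VertexOperator.ncoeff (𝒱.Y 𝒱.vir) 1) (n : ℂ))
        (fun x => (mem_fixed_eigenspace ρ x.1 n).1 x.2)) ?_
    intro x y h
    have h' := congrArg Subtype.val h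
    exact Subtype.ext (Subtype.ext h')
  degree_zero := by
    ext x
    rw [mem_fixed_eigenspace, 𝒱.degree_zero, Submodule.mem_span_singleton,
      Submodule.mem_span_singleton]
    constructor
    · rintro ⟨r, hr⟩
      exact ⟨r, Subtype.ext hr⟩
    · rintro ⟨r, hr⟩
      exact ⟨r, congrArg Subtype.val hr⟩

end fixed

/-! ### Modules and conformal designs -/

/-- An (ordinary) module over a vertex operator algebra. -/
structure Mod (𝒱 : VOA V) (N : Type v) [AddCommGroup N] [Module ℂ N] where
  /-- the vertex operators `Y_N(v, z) = ∑ v₍ₙ₎ z⁻ⁿ⁻¹` on `N` -/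
  Y : V →ₗ[ℂ] VertexOperator ℂ N
  vac_mode : ∀ n : ℤ, VertexOperator.ncoeff (Y 𝒱.vac) n = if n = -1 then 1 else 0
  /-- the Borcherds (Jacobi) identity in components -/
  borcherds : ∀ (a b : V) (x : N) (m n k : ℤ),
    ∑ᶠ i : ℕ, ((Ring.choose m i : ℤ) : ℂ) •
      VertexOperator.ncoeff (Y (𝒱.mode a (n + i) b)) (m + k - i) x =
    ∑ᶠ i : ℕ, ((-1 : ℂ) ^ i * ((Ring.choose n i : ℤ) : ℂ)) •
      (VertexOperator.ncoeff (Y a) (m + n - i) (VertexOperator.ncoeff (Y b) (k + i) x) -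
        (-1 : ℂ) ^ n •
          VertexOperator.ncoeff (Y b) (n + k - i) (VertexOperator.ncoeff (Y a) (m + i) x))
  /-- `Y_N(L₋₁ v, z) = d/dz Y_N(v, z)` -/
  derivative : ∀ (v : V) (n : ℤ),
    VertexOperator.ncoeff (Y (𝒱.L (-1) v)) n = (-n : ℂ) • VertexOperator.ncoeff (Y v) (n - 1)
  /-- `N` is the sum (automatically direct) of the eigenspaces `N_h` of `L₀` -/
  grading : ⨆ h : ℂ, Module.End.eigenspace (VertexOperator.ncoeff (Y 𝒱.vir) 1) h = ⊤
  finite_dim : ∀ h : ℂ,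
    FiniteDimensional ℂ (Module.End.eigenspace (VertexOperator.ncoeff (Y 𝒱.vir) 1) h)
  /-- for fixed `h`, `N_{h - n} = 0` for all large `n` -/
  lower_bound : ∀ h : ℂ, ∃ n₀ : ℕ, ∀ n : ℕ, n₀ ≤ n →
    Module.End.eigenspace (VertexOperator.ncoeff (Y 𝒱.vir) 1) (h - n) = ⊥

namespace Mod

variable {𝒱 : VOA V} {N : Type v} [AddCommGroup N] [Module ℂ N]

/-- The mode `v₍ₙ₎` acting on the module. -/
def mode (M : 𝒱.Mod N) (v : V) (n : ℤ) : Module.End ℂ N := VertexOperator.ncoeff (M.Y v) n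

/-- The homogeneous subspace `N_h`: the eigenspace of `L₀ = ω₍₁₎` with eigenvalue `h`. -/
def degree (M : 𝒱.Mod N) (h : ℂ) : Submodule ℂ N := Module.End.eigenspace (M.mode 𝒱.vir 1) h

theorem L0_commutator (M : 𝒱.Mod N) (v : V) (k : ℤ) (x : N) :
    M.mode 𝒱.vir 1 (M.mode v k x) - M.mode v k (M.mode 𝒱.vir 1 x) =
      M.mode (𝒱.L (-1) v) (k + 1) x + M.mode (𝒱.L 0 v) k x := by
  have h := M.borcherds 𝒱.vir v x 1 0 k
  rw [finsum_eq_sum_of_support_subset (s := {0, 1}), finsum_eq_sum_of_support_subset (s := {0})] at h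
  · simp only [Finset.sum_singleton, Finset.mem_singleton, zero_ne_one, not_false_eq_true,
      Finset.sum_insert, Ring.choose_zero_right, Ring.choose_one_right] at h
    simp only [mode, L, VOA.mode] at *
    simp at h
    rw [← h]
    simp [add_comm]
  · intro i hi
    by_contra h0
    have h0 : i ≠ 0 := by simpa using h0
    apply hi
    simp [Ring.choose_zero_pos ℤ (Nat.pos_of_ne_zero h0)]
  · intro i hi
    by_contra h0
    have h0 : 1 < i := by
      simp at h0; omega
    apply hi
    have : Ring.choose (1 : ℤ) i = 0 := by
      have := Ring.choose_natCast (R := ℤ) 1 i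
      rw [Nat.choose_eq_zero_of_lt h0] at this
      exact_mod_cast this
    simp [this]

theorem zeroMode_mem (M : 𝒱.Mod N) {n : ℕ} {v : V} (hv : v ∈ 𝒱.degree n) (h : ℂ) :
    ∀ x ∈ M.degree h, M.mode v ((n : ℤ) - 1) x ∈ M.degree h := by
  intro x hx
  have hx' : M.mode 𝒱.vir 1 x = h • x := Module.End.mem_eigenspace_iff.1 hx
  apply Module.End.mem_eigenspace_iff.2
  have h1 := M.L0_commutator v ((n : ℤ) - 1) x
  have h2 := LinearMap.congr_fun (M.derivative v ((n : ℤ) - 1 + 1)) x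
  have h3 : M.mode (𝒱.L 0 v) ((n : ℤ) - 1) x = (n : ℂ) • M.mode v ((n : ℤ) - 1) x := by
    rw [(𝒱.mem_degree).1 hv]; simp [mode]
  change M.mode (𝒱.L (-1) v) ((n : ℤ) - 1 + 1) x = _ at h2
  rw [h2, h3, hx', map_smul] at h1
  have h4 : ((-((((n : ℤ) - 1 + 1 : ℤ)) : ℂ)) •
      VertexOperator.ncoeff (M.Y v) ((n : ℤ) - 1 + 1 - 1)) x =
      -((n : ℂ) • M.mode v ((n : ℤ) - 1) x) := by
    simp [mode]
  rw [h4, neg_add_cancel, sub_eq_zero] at h1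
  exact h1

/-- For `v` of degree `n`, the operator `o(v) = v₍ₙ₋₁₎` restricted to `X = N_h`, which it maps to
itself. -/
def zeroMode (M : 𝒱.Mod N) {n : ℕ} {v : V} (hv : v ∈ 𝒱.degree n) (h : ℂ) :
    Module.End ℂ (M.degree h) :=
  (M.mode v ((n : ℤ) - 1)).restrict (M.zeroMode_mem hv h)

/-- The homogeneous subspace `X = N_h` is a conformal `t`-design:
`tr|_X o(v) = tr|_X o(π(v))` for all `v` of degree at most `t`. -/
def IsConformalDesign (M : 𝒱.Mod N) (D : 𝒱.Decomposition) (h : ℂ) (t : ℕ) : Prop :=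
  ∀ (n : ℕ), n ≤ t → ∀ (v : V) (hv : v ∈ 𝒱.degree n),
    LinearMap.trace ℂ (M.degree h) (M.zeroMode hv h) =
      LinearMap.trace ℂ (M.degree h) (M.zeroMode (D.π_mem_degree hv) h)

/-- The module `N` is `G`-invariant: some central extension `Ĝ` of `G` acts linearly on `N` such
that `g⁻¹ Y_N(ḡ v, z) g = Y_N(v, z)` for all `g ∈ Ĝ` with image `ḡ ∈ G`. -/
def IsInvariant {G : Type w} [Group G] (M : 𝒱.Mod N) (ρ : G →* 𝒱.aut) : Prop :=
  ∃ (Ghat : Type x) (_ : Group Ghat) (p : Ghat →* G) (σ : Ghat →* (N ≃ₗ[ℂ] N)),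
    Function.Surjective p ∧ p.ker ≤ Subgroup.center Ghat ∧
    ∀ (g : Ghat) (v : V) (n : ℤ) (x : N),
      (σ g)⁻¹ (M.mode ((ρ (p g) : V ≃ₗ[ℂ] V) v) n (σ g x)) = M.mode v n x

end Mod

end VOA

end

namespace VOA

variable {V : Type u} [AddCommGroup V] [Module ℂ V]

/-! ### Highest weight modules are bounded below by their highest weight -/

/-! The trace of `o(v)` on `N_h` is a linear functional of `v ∈ Vₙ`, and it is constant on
`G`-orbits: a lift of `g` to the central extension conjugates `o(v)` into `o(gv)`
(`Mod.IsInvariant.trace_zeroMode`). Hence it takes the same value at `v` and at the Haar average `w`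
of the orbit of `v` (`exists_average`). It remains to see that `w = π(v)` when `n ≤ t`.

The average is a fixed vector of degree below the minimal weight of `V^G`. A highest weight module
of weight `h` lives in degrees at least `h`, so `w` has no component outside the Virasoro module of
the vacuum; thus `w ∈ V_ω` and `π(w) = w` (`coe_mem_virasoroSpan_vac_of_le_minimalWeight`).

On the other hand `π(gv) = π(v)` (`Decomposition.IsNatural.π_aut`): `g` carries one decomposition to
another, naturality makes both give the same projection, and `g` fixes `V_ω` pointwise. So `π` is
constant on the orbit, and `π(w) = π(v)`. -/

theorem L_commutator (𝒱 : VOA V) (m n : ℤ) (x : V) :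
    𝒱.L m (𝒱.L n x) = 𝒱.L n (𝒱.L m x) + ((m : ℂ) - n) • 𝒱.L (m + n) x +
      (if m + n = 0 then ((m : ℂ) ^ 3 - m) / 12 * 𝒱.c else 0) • x := by
  have h := LinearMap.congr_fun (𝒱.virasoro m n) x
  simp only [Ring.lie_def, LinearMap.sub_apply, Module.End.mul_apply, LinearMap.add_apply,
    LinearMap.smul_apply, Module.End.one_apply] at h
  rw [sub_eq_iff_eq_add] at h
  simp only [L, mode]
  rw [h]
  abel

/-- `Lₙ` lowers the degree by `n`. -/
theorem L_neg_mem_degree (𝒱 : VOA V) {k : ℕ} (j : ℕ) {v : V} (hv : v ∈ 𝒱.degree k) :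
    𝒱.L (-j) v ∈ 𝒱.degree (k + j) := by
  rw [mem_degree] at hv ⊢
  rw [L_commutator, hv, map_smul]
  by_cases hj : j = 0
  · subst hj
    simp [hv]
  · simp [hj, add_smul]

/-- The sum of the homogeneous subspaces of degree at least `k`. -/
def degreeGE (𝒱 : VOA V) (k : ℕ) : Submodule ℂ V := ⨆ (n : ℕ) (_ : k ≤ n), 𝒱.degree n

theorem degree_le_degreeGE (𝒱 : VOA V) {k n : ℕ} (h : k ≤ n) : 𝒱.degree n ≤ 𝒱.degreeGE k :=
  le_iSup₂_of_le (f := fun (n : ℕ) (_ : k ≤ n) => 𝒱.degree n) n h le_rfl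

theorem degreeGE_anti (𝒱 : VOA V) {k l : ℕ} (h : k ≤ l) : 𝒱.degreeGE l ≤ 𝒱.degreeGE k :=
  iSup₂_le fun _ hn => 𝒱.degree_le_degreeGE (h.trans hn)

theorem L_neg_mem_degreeGE (𝒱 : VOA V) {k : ℕ} (j : ℕ) {v : V} (hv : v ∈ 𝒱.degreeGE k) :
    𝒱.L (-j) v ∈ 𝒱.degreeGE k := by
  suffices H : 𝒱.degreeGE k ≤ (𝒱.degreeGE k).comap (𝒱.L (-j)) from H hv
  exact iSup₂_le fun n hn x hx =>
    𝒱.degree_le_degreeGE (hn.trans (Nat.le_add_right n j)) (𝒱.L_neg_mem_degree j hx)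

theorem iSupIndep_degree (𝒱 : VOA V) : iSupIndep 𝒱.degree :=
  (Module.End.eigenspaces_iSupIndep (𝒱.L 0)).comp Nat.cast_injective

theorem disjoint_degree_degreeGE (𝒱 : VOA V) {k n : ℕ} (h : n < k) :
    Disjoint (𝒱.degree n) (𝒱.degreeGE k) :=
  (𝒱.iSupIndep_degree n).mono_right (iSup₂_le fun m hm =>
    le_iSup₂_of_le (f := fun (j : ℕ) (_ : j ≠ n) => 𝒱.degree j) m (h.trans_le hm).ne' le_rfl)

theorem mem_virasoroSpan_self (𝒱 : VOA V) (v : V) : v ∈ 𝒱.virasoroSpan v :=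
  Submodule.mem_sInf.2 fun _ hW => hW.1

theorem virasoroSpan_le (𝒱 : VOA V) {v : V} {W : Submodule ℂ V} (hv : v ∈ W)
    (hW : ∀ (n : ℤ), ∀ x ∈ W, 𝒱.L n x ∈ W) : 𝒱.virasoroSpan v ≤ W := sInf_le ⟨hv, hW⟩

/-- The subspace generated from `v` by the operators `Lₙ` with `n < 0`. -/
def loweringSpan (𝒱 : VOA V) (v : V) : Submodule ℂ V :=
  sInf {W | v ∈ W ∧ ∀ (n : ℤ), n < 0 → ∀ x ∈ W, 𝒱.L n x ∈ W}

theorem loweringSpan_le (𝒱 : VOA V) {v : V} {W : Submodule ℂ V} (hv : v ∈ W)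
    (hW : ∀ (n : ℤ), n < 0 → ∀ x ∈ W, 𝒱.L n x ∈ W) : 𝒱.loweringSpan v ≤ W := sInf_le ⟨hv, hW⟩

theorem mem_loweringSpan_self (𝒱 : VOA V) (v : V) : v ∈ 𝒱.loweringSpan v :=
  Submodule.mem_sInf.2 fun _ hW => hW.1

theorem L_mem_loweringSpan (𝒱 : VOA V) (v : V) {n : ℤ} (hn : n < 0) {x : V}
    (hx : x ∈ 𝒱.loweringSpan v) : 𝒱.L n x ∈ 𝒱.loweringSpan v :=
  Submodule.mem_sInf.2 fun W hW => hW.2 n hn x (Submodule.mem_sInf.1 hx W hW)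

/-- This replaces the Poincaré–Birkhoff–Witt argument: commuting nonnegative modes to the right
until they reach `v` shows that negative modes alone generate the module. The induction runs over
the subspace `P` of vectors which every `Lₙ` keeps in the lowering span. -/
theorem IsHighestWeight.L_mem_loweringSpan {𝒱 : VOA V} {h : ℕ} {v : V}
    (hv : 𝒱.IsHighestWeight h v) (n : ℤ) {x : V} (hx : x ∈ 𝒱.loweringSpan v) :
    𝒱.L n x ∈ 𝒱.loweringSpan v := by
  let P : Submodule ℂ V := 𝒱.loweringSpan v ⊓ ⨅ n : ℤ, (𝒱.loweringSpan v).comap (𝒱.L n)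
  suffices H : 𝒱.loweringSpan v ≤ P from (Submodule.mem_iInf _).1 (H hx).2 n
  refine 𝒱.loweringSpan_le ⟨𝒱.mem_loweringSpan_self v, (Submodule.mem_iInf _).2 fun m => ?_⟩ ?_
  · rcases lt_trichotomy m 0 with hm | rfl | hm
    · exact 𝒱.L_mem_loweringSpan v hm (𝒱.mem_loweringSpan_self v)
    · change 𝒱.L 0 v ∈ 𝒱.loweringSpan v
      rw [𝒱.mem_degree.1 hv.2.1]
      exact Submodule.smul_mem _ _ (𝒱.mem_loweringSpan_self v)
    · change 𝒱.L m v ∈ 𝒱.loweringSpan v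
      rw [hv.2.2 m hm]
      exact zero_mem _
  · rintro k hk y ⟨hy1, hy2⟩
    have hy : ∀ m, 𝒱.L m y ∈ 𝒱.loweringSpan v := (Submodule.mem_iInf _).1 hy2
    refine ⟨hy k, (Submodule.mem_iInf _).2 fun m => ?_⟩
    change 𝒱.L m (𝒱.L k y) ∈ 𝒱.loweringSpan v
    -- All three terms use `y ∈ P`: `L k` with `k < 0` preserves the span and is applied to `L m y`,
    -- then come `L (m + k) y` and the central multiple of `y`.
    rw [L_commutator]
    exact add_mem (add_mem (𝒱.L_mem_loweringSpan v hk (hy m)) (Submodule.smul_mem _ _ (hy _)))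
      (Submodule.smul_mem _ _ hy1)

/-- Negative modes only raise the degree, and by the preceding lemma no others are needed to
generate the module. -/
theorem IsHighestWeight.virasoroSpan_le_degreeGE {𝒱 : VOA V} {h : ℕ} {v : V}
    (hv : 𝒱.IsHighestWeight h v) : 𝒱.virasoroSpan v ≤ 𝒱.degreeGE h := by
  refine (𝒱.virasoroSpan_le (𝒱.mem_loweringSpan_self v)
    fun n _ hx => hv.L_mem_loweringSpan n hx).trans
    (𝒱.loweringSpan_le (𝒱.degree_le_degreeGE le_rfl hv.2.1) fun n hn x hx => ?_)
  obtain ⟨j, rfl⟩ : ∃ j : ℕ, n = -j := ⟨n.natAbs, by omega⟩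
  exact 𝒱.L_neg_mem_degreeGE j hx

/-! ### Degree bounds and the projection onto `M̄(0)` -/

namespace Decomposition

variable {𝒱 : VOA V}

theorem isotypic_le_degreeGE (D : Decomposition 𝒱) (h : ℕ) : D.isotypic h ≤ 𝒱.degreeGE h := by
  refine iSup₂_le fun v hv => ?_
  obtain ⟨k, hk⟩ := D.highest v v.2
  obtain rfl := degree_unique hk.1 hk.2.1 hv
  exact hk.virasoroSpan_le_degreeGE

theorem positive_le_degreeGE_one (D : Decomposition 𝒱) : D.positive ≤ 𝒱.degreeGE 1 :=
  iSup₂_le fun h hh => (D.isotypic_le_degreeGE h).trans (𝒱.degreeGE_anti hh)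

theorem positive_le_degreeGE_of_le_minimalWeight (D : Decomposition 𝒱) {k : ℕ}
    (hk : (k : ℕ∞) ≤ D.minimalWeight) : D.positive ≤ 𝒱.degreeGE k := by
  refine iSup₂_le fun h hh => ?_
  by_cases hb : D.isotypic h = ⊥
  · rw [hb]
    exact bot_le
  · have : (k : ℕ∞) ≤ h := hk.trans (iInf₂_le h ⟨hh, hb⟩)
    exact (D.isotypic_le_degreeGE h).trans (𝒱.degreeGE_anti (by exact_mod_cast this))

theorem π_mem (D : Decomposition 𝒱) (v : V) : D.π v ∈ D.isotypic 0 :=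
  Submodule.projection_apply_mem D.isCompl v

theorem π_eq_self (D : Decomposition 𝒱) {v : V} (hv : v ∈ D.isotypic 0) : D.π v = v :=
  Submodule.projection_apply_left D.isCompl ⟨v, hv⟩

theorem ker_π (D : Decomposition 𝒱) : LinearMap.ker D.π = D.positive :=
  Submodule.ker_projection D.isCompl

theorem sub_π_mem (D : Decomposition 𝒱) (v : V) : v - D.π v ∈ D.positive := by
  rw [← ker_π, LinearMap.mem_ker, map_sub, D.π_eq_self (D.π_mem v), sub_self]

/-- The component `v - π(v)` has degree `n`, but it also lies in degrees at least `k > n`, so it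
vanishes. -/
theorem mem_isotypic_zero_of_degree_lt (D : Decomposition 𝒱) {n k : ℕ} (hnk : n < k)
    (hD : D.positive ≤ 𝒱.degreeGE k) {v : V} (hv : v ∈ 𝒱.degree n) : v ∈ D.isotypic 0 := by
  have h : v - D.π v = 0 := Submodule.disjoint_def.1 (𝒱.disjoint_degree_degreeGE hnk) _
    (sub_mem hv (D.π_mem_degree hv)) (hD (D.sub_π_mem v))
  rw [sub_eq_zero.1 h]
  exact D.π_mem v

/-- `M̄(0)` is the Virasoro submodule generated by the vacuum. -/
theorem isotypic_zero (D : Decomposition 𝒱) : D.isotypic 0 = 𝒱.virasoroSpan 𝒱.vac := by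
  have hvac : 𝒱.degree 0 = Submodule.span ℂ {𝒱.vac} := by
    have := 𝒱.degree_zero
    rw [← Nat.cast_zero] at this
    exact this
  apply le_antisymm
  · refine iSup₂_le fun v hv => 𝒱.virasoroSpan_le ?_ fun n x hx => 𝒱.L_mem_virasoroSpan _ n hx
    -- A generator of weight `0` lies in `V₀ = ℂ 𝟏`, so it is a multiple of the vacuum.
    have hv' : (v : V) ∈ 𝒱.degree 0 := hv
    rw [hvac] at hv'
    exact (Submodule.span_singleton_le_iff_mem _ _).2 (𝒱.mem_virasoroSpan_self _) hv'
  · refine 𝒱.virasoroSpan_le ?_ fun n x hx => D.L_mem_isotypic 0 n hx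
    -- The vacuum need not be one of the chosen generators; it lies in `M̄(0)` because the other
    -- summands start in degree `1`.
    refine D.mem_isotypic_zero_of_degree_lt zero_lt_one D.positive_le_degreeGE_one ?_
    rw [hvac]
    exact Submodule.mem_span_singleton_self _

end Decomposition

/-! ### Automorphisms -/

section aut

variable {𝒱 : VOA V}

theorem aut_L (g : 𝒱.aut) (n : ℤ) (x : V) :
    (g : V ≃ₗ[ℂ] V) (𝒱.L n x) = 𝒱.L n ((g : V ≃ₗ[ℂ] V) x) := by
  have h := g.2.2.2 𝒱.vir x (n + 1)
  rw [g.2.2.1] at h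
  exact h

theorem aut_mem_degree (g : 𝒱.aut) {n : ℕ} {v : V} (hv : v ∈ 𝒱.degree n) :
    (g : V ≃ₗ[ℂ] V) v ∈ 𝒱.degree n := by
  rw [mem_degree] at hv ⊢
  rw [← aut_L, hv, map_smul]

/-- An automorphism fixes `ω`, hence commutes with every `Lₙ`, so its fixed vectors form a Virasoro
submodule; this submodule contains the vacuum. -/
theorem aut_apply_eq_self_of_mem_virasoroSpan_vac (g : 𝒱.aut) {v : V}
    (hv : v ∈ 𝒱.virasoroSpan 𝒱.vac) : (g : V ≃ₗ[ℂ] V) v = v := by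
  have h : 𝒱.virasoroSpan 𝒱.vac ≤
      LinearMap.eqLocus (g : V ≃ₗ[ℂ] V).toLinearMap LinearMap.id := by
    refine 𝒱.virasoroSpan_le g.2.1 fun n x hx => ?_
    have hx' : (g : V ≃ₗ[ℂ] V) x = x := hx
    change (g : V ≃ₗ[ℂ] V) (𝒱.L n x) = 𝒱.L n x
    rw [aut_L, hx']
  exact h hv

theorem map_virasoroSpan_le (g : 𝒱.aut) (v : V) :
    (𝒱.virasoroSpan v).map (g : V ≃ₗ[ℂ] V).toLinearMap ≤
      𝒱.virasoroSpan ((g : V ≃ₗ[ℂ] V) v) := by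
  rw [Submodule.map_le_iff_le_comap]
  refine 𝒱.virasoroSpan_le (𝒱.mem_virasoroSpan_self _) fun n x hx => ?_
  change (g : V ≃ₗ[ℂ] V) (𝒱.L n x) ∈ 𝒱.virasoroSpan ((g : V ≃ₗ[ℂ] V) v)
  rw [aut_L]
  exact 𝒱.L_mem_virasoroSpan _ n hx

theorem virasoroSpan_aut (g : 𝒱.aut) (v : V) : 𝒱.virasoroSpan ((g : V ≃ₗ[ℂ] V) v) =
    (𝒱.virasoroSpan v).map (g : V ≃ₗ[ℂ] V).toLinearMap := by
  refine le_antisymm (𝒱.virasoroSpan_le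
    (Submodule.mem_map_of_mem (𝒱.mem_virasoroSpan_self v)) ?_) (map_virasoroSpan_le g v)
  rintro n _ ⟨x, hx, rfl⟩
  exact ⟨𝒱.L n x, 𝒱.L_mem_virasoroSpan v n hx, aut_L g n x⟩

theorem IsHighestWeight.aut_apply {h : ℕ} {v : V} (hv : 𝒱.IsHighestWeight h v) (g : 𝒱.aut) :
    𝒱.IsHighestWeight h ((g : V ≃ₗ[ℂ] V) v) :=
  ⟨(g : V ≃ₗ[ℂ] V).map_ne_zero_iff.2 hv.1, aut_mem_degree g hv.2.1, fun n hn => by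
    rw [← aut_L, hv.2.2 n hn, map_zero]⟩

/-- The image of a decomposition under an automorphism. -/
def Decomposition.translate (D : Decomposition 𝒱) (g : 𝒱.aut) : Decomposition 𝒱 where
  gens := (g : V ≃ₗ[ℂ] V) '' D.gens
  highest := by
    rintro _ ⟨v, hv, rfl⟩
    obtain ⟨h, hh⟩ := D.highest v hv
    exact ⟨h, hh.aut_apply g⟩
  independent := by
    -- Pulling submodules back along `g` is a lattice isomorphism, and it turns the new family into
    -- the old one, reindexed by the bijection of generators.
    rw [← iSupIndep_map_orderIso_iff
      (Submodule.orderIsoMapComap (g : V ≃ₗ[ℂ] V)).symm]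
    refine (iSupIndep.comp D.independent (f := fun v : (g : V ≃ₗ[ℂ] V) '' D.gens =>
      ((Equiv.Set.image (g : V ≃ₗ[ℂ] V) D.gens (g : V ≃ₗ[ℂ] V).injective).symm v))
      (Equiv.injective _)).mono ?_
    rintro ⟨_, v, hv, rfl⟩
    have : (Equiv.Set.image (g : V ≃ₗ[ℂ] V) D.gens (g : V ≃ₗ[ℂ] V).injective).symm
        ⟨(g : V ≃ₗ[ℂ] V) v, v, hv, rfl⟩ = ⟨v, hv⟩ :=
      Subtype.ext (congrArg Subtype.val (Equiv.symm_apply_apply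
        (Equiv.Set.image (g : V ≃ₗ[ℂ] V) D.gens (g : V ≃ₗ[ℂ] V).injective) ⟨v, hv⟩))
    simp only [Function.comp_apply, this, virasoroSpan_aut]
    exact ((Submodule.orderIsoMapComap (g : V ≃ₗ[ℂ] V)).symm_apply_apply _).le
  total := by
    have h := congrArg (Submodule.map (g : V ≃ₗ[ℂ] V).toLinearMap) D.total
    rw [Submodule.map_iSup, Submodule.map_top, LinearMap.range_eq_top.2
      (g : V ≃ₗ[ℂ] V).surjective] at h
    rw [eq_top_iff, ← h]
    refine iSup_le fun v => ?_
    rw [← virasoroSpan_aut]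
    exact le_iSup (fun w : (g : V ≃ₗ[ℂ] V) '' D.gens => 𝒱.virasoroSpan (w : V))
      ⟨_, Set.mem_image_of_mem _ v.2⟩

theorem Decomposition.aut_mem_isotypic (D : Decomposition 𝒱) (g : 𝒱.aut) (h : ℕ) {x : V}
    (hx : x ∈ D.isotypic h) : (g : V ≃ₗ[ℂ] V) x ∈ (D.translate g).isotypic h := by
  suffices H : D.isotypic h ≤
      ((D.translate g).isotypic h).comap (g : V ≃ₗ[ℂ] V).toLinearMap from H hx
  refine iSup₂_le fun v hv => ?_
  rw [← Submodule.map_le_iff_le_comap, ← virasoroSpan_aut]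
  exact le_iSup₂_of_le (f := fun (w : (D.translate g).gens)
    (_ : w ∈ {w : (D.translate g).gens | (w : V) ∈ 𝒱.degree h}) => 𝒱.virasoroSpan (w : V))
    ⟨_, Set.mem_image_of_mem _ v.2⟩ (aut_mem_degree g hv) le_rfl

theorem Decomposition.aut_mem_positive (D : Decomposition 𝒱) (g : 𝒱.aut) {x : V}
    (hx : x ∈ D.positive) : (g : V ≃ₗ[ℂ] V) x ∈ (D.translate g).positive := by
  suffices H : D.positive ≤
      ((D.translate g).positive).comap (g : V ≃ₗ[ℂ] V).toLinearMap from H hx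
  exact iSup₂_le fun h hh x hx => le_iSup₂_of_le
    (f := fun (h : ℕ) (_ : 0 < h) => (D.translate g).isotypic h) h hh le_rfl
    (D.aut_mem_isotypic g h hx)

/-- A natural projection `π` is invariant under automorphisms. -/
theorem Decomposition.IsNatural.π_aut {D : Decomposition 𝒱} (hD : D.IsNatural) (g : 𝒱.aut)
    (v : V) : D.π ((g : V ≃ₗ[ℂ] V) v) = D.π v := by
  -- `g` maps the kernel of `π` into the kernel of the projection of the translated decomposition,
  -- which by naturality is `π` again.
  have h1 : (D.translate g).π ((g : V ≃ₗ[ℂ] V) (v - D.π v)) = 0 := by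
    rw [← LinearMap.mem_ker, ker_π]
    exact D.aut_mem_positive g (D.sub_π_mem v)
  have h2 : (g : V ≃ₗ[ℂ] V) (D.π v) = D.π v :=
    aut_apply_eq_self_of_mem_virasoroSpan_vac g (D.isotypic_zero ▸ D.π_mem v)
  rwa [hD, map_sub, map_sub, h2, D.π_eq_self (D.π_mem v), sub_eq_zero] at h1

end aut

/-! ### Fixed points -/

section fixed

variable {𝒱 : VOA V} {G : Type w} [Group G] (ρ : G →* 𝒱.aut)

theorem coe_fixed_L (n : ℤ) (x : 𝒱.fixedSpace ρ) : ((fixed ρ).L n x : V) = 𝒱.L n x :=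
  coe_ncoeff_fixedY ρ _ x (n + 1)

theorem mem_fixed_degree {n : ℕ} (x : 𝒱.fixedSpace ρ) :
    x ∈ (fixed ρ).degree n ↔ (x : V) ∈ 𝒱.degree n :=
  mem_fixed_eigenspace ρ x n

/-- `V^G` and `V` share the Virasoro vector, so the inclusion intertwines the operators `Lₙ`. -/
theorem coe_mem_virasoroSpan_of_fixed {v x : 𝒱.fixedSpace ρ}
    (hx : x ∈ (fixed ρ).virasoroSpan v) : (x : V) ∈ 𝒱.virasoroSpan (v : V) := by
  suffices H : (fixed ρ).virasoroSpan v ≤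
      (𝒱.virasoroSpan (v : V)).comap (𝒱.fixedSpace ρ).subtype from H hx
  refine (fixed ρ).virasoroSpan_le (𝒱.mem_virasoroSpan_self _) fun n y hy => ?_
  change ((fixed ρ).L n y : V) ∈ 𝒱.virasoroSpan (v : V)
  rw [coe_fixed_L]
  exact 𝒱.L_mem_virasoroSpan _ n hy

theorem coe_fixed_vac : ((fixed ρ).vac : V) = 𝒱.vac := rfl

/-- Below the minimal weight of `V^G`, the fixed vectors lie in `V_ω`. -/
theorem coe_mem_virasoroSpan_vac_of_le_minimalWeight {t n : ℕ} (DG : (fixed ρ).Decomposition)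
    (hDG : (t : ℕ∞) + 1 ≤ DG.minimalWeight) (hn : n ≤ t) {v : 𝒱.fixedSpace ρ}
    (hv : (v : V) ∈ 𝒱.degree n) : (v : V) ∈ 𝒱.virasoroSpan 𝒱.vac := by
  have hle : DG.positive ≤ (fixed ρ).degreeGE (t + 1) :=
    DG.positive_le_degreeGE_of_le_minimalWeight (by rwa [Nat.cast_add, Nat.cast_one])
  have h := DG.mem_isotypic_zero_of_degree_lt (Nat.lt_succ_of_le hn) hle
    ((mem_fixed_degree ρ v).2 hv)
  rw [DG.isotypic_zero] at h
  have h' := coe_mem_virasoroSpan_of_fixed ρ h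
  rwa [coe_fixed_vac] at h'

end fixed

/-! ### Traces of zero modes -/

namespace Mod

variable {𝒱 : VOA V} {N : Type v} [AddCommGroup N] [Module ℂ N]

/-- The linear functional `v ↦ tr|_{N_h} o(v)` on `Vₙ`. -/
noncomputable def traceZeroMode (M : 𝒱.Mod N) (h : ℂ) (n : ℕ) : Module.Dual ℂ (𝒱.degree n) where
  toFun v := LinearMap.trace ℂ (M.degree h) (M.zeroMode v.2 h)
  map_add' a b := by
    rw [← map_add]
    congr 1
    apply LinearMap.ext
    intro x
    apply Subtype.ext
    change M.mode ((a : V) + b) _ (x : N) = M.mode (a : V) _ (x : N) + M.mode (b : V) _ (x : N)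
    simp [mode]
  map_smul' r a := by
    rw [← map_smul]
    congr 1
    apply LinearMap.ext
    intro x
    apply Subtype.ext
    change M.mode (r • (a : V)) _ (x : N) = r • M.mode (a : V) _ (x : N)
    simp [mode]

/-- Any lift of `g` acts on `N` commuting with `L₀`, since `g` fixes `ω`. It therefore preserves
`N_h` and conjugates `o(v)` into `o(gv)` there, and the trace is invariant under conjugation. -/
theorem IsInvariant.trace_zeroMode {G : Type w} [Group G] {M : 𝒱.Mod N} {ρ : G →* 𝒱.aut}
    (hM : M.IsInvariant.{u, v, w, x} ρ) (h : ℂ) {n : ℕ} {v : V} (hv : v ∈ 𝒱.degree n) (g : G) :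
    LinearMap.trace ℂ (M.degree h) (M.zeroMode (aut_mem_degree (ρ g) hv) h) =
      LinearMap.trace ℂ (M.degree h) (M.zeroMode hv h) := by
  obtain ⟨Ghat, _, p, σ, hp, -, hσ⟩ := hM
  obtain ⟨g, rfl⟩ := hp g
  have hmode : ∀ (v : V) (n : ℤ) (x : N),
      M.mode ((ρ (p g) : V ≃ₗ[ℂ] V) v) n (σ g x) = σ g (M.mode v n x) := by
    intro v n x
    rw [← hσ g v n x]
    exact ((σ g).apply_symm_apply _).symm
  have hdeg : (M.degree h).map (σ g).toLinearMap = M.degree h := by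
    have hvir : ∀ x, M.mode 𝒱.vir 1 (σ g x) = σ g (M.mode 𝒱.vir 1 x) := by
      intro x
      rw [← hmode, (ρ (p g)).2.2.1]
    ext y
    obtain ⟨y, rfl⟩ := (σ g).surjective y
    change σ g y ∈ (M.degree h).map (σ g).toLinearMap ↔ _
    rw [Submodule.mem_map_equiv, LinearEquiv.symm_apply_apply]
    simp only [degree, Module.End.mem_eigenspace_iff]
    rw [hvir, ← map_smul, (σ g).injective.eq_iff]
  let e : M.degree h ≃ₗ[ℂ] M.degree h := (σ g).ofSubmodules _ _ hdeg
  rw [← LinearMap.trace_conj' (M.zeroMode hv h) e]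
  congr 1
  apply LinearMap.ext
  intro y
  obtain ⟨y, rfl⟩ := e.surjective y
  apply Subtype.ext
  rw [LinearEquiv.conj_apply_apply, LinearEquiv.symm_apply_apply]
  exact hmode v _ y

end Mod

/-! ### Averaging over a compact group -/

section average

open MeasureTheory

variable {𝒱 : VOA V} {G : Type w} [Group G] [TopologicalSpace G]

/-- The average of a homogeneous vector over a compact group, characterized weakly: functionals
which are constant on the orbit of `v` take the same value on the average. -/
theorem exists_average [IsTopologicalGroup G] [CompactSpace G] (ρ : G →* 𝒱.aut)
    (hρ : ∀ (φ : Module.Dual ℂ V) (v : V), Continuous fun g : G => φ ((ρ g : V ≃ₗ[ℂ] V) v))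
    {n : ℕ} {v : V} (hv : v ∈ 𝒱.degree n) :
    ∃ w ∈ 𝒱.degree n, w ∈ 𝒱.fixedSpace ρ ∧ ∀ φ : Module.Dual ℂ V,
      (∀ g : G, φ ((ρ g : V ≃ₗ[ℂ] V) v) = φ v) → φ w = φ v := by
  let _ : MeasurableSpace G := borel G
  have : BorelSpace G := ⟨rfl⟩
  -- Normalizing on the whole compact group gives `G` total mass `1`.
  let μ : Measure G := Measure.haarMeasure ⊤
  have : IsProbabilityMeasure μ := ⟨by
    have := Measure.haarMeasure_self (K₀ := (⊤ : TopologicalSpace.PositiveCompacts G))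
    simpa using this⟩
  have : FiniteDimensional ℂ (𝒱.degree n) := 𝒱.finite_dim n
  have hint : ∀ (φ : Module.Dual ℂ V) (v : V),
      Integrable (fun g : G => φ ((ρ g : V ≃ₗ[ℂ] V) v)) μ := fun φ v =>
    (hρ φ v).integrable_of_hasCompactSupport (HasCompactSupport.of_compactSpace _)
  let b := Module.finBasis ℂ (𝒱.degree n)
  -- The coordinates on `Vₙ` are extended to `V`, since continuity of the action is given through
  -- functionals on `V`. The average is then integrated coordinate by coordinate, with no topology
  -- on `V`.
  choose β hβ using fun i => LinearMap.exists_extend (b.coord i)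
  have hβ' : ∀ i (x : 𝒱.degree n), β i (x : V) = b.repr x i := fun i x =>
    LinearMap.congr_fun (hβ i) x
  have hsum : ∀ y ∈ 𝒱.degree n, y = ∑ i, β i y • (b i : V) := by
    intro y hy
    have h := congrArg Subtype.val (b.sum_repr ⟨y, hy⟩)
    rw [AddSubmonoidClass.coe_finsetSum] at h
    refine h.symm.trans (Finset.sum_congr rfl fun i _ => ?_)
    rw [Submodule.coe_smul, ← hβ']
  have key : ∀ φ : Module.Dual ℂ V,
      φ (∑ i, (∫ g, β i ((ρ g : V ≃ₗ[ℂ] V) v) ∂μ) • (b i : V)) =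
        ∫ g, φ ((ρ g : V ≃ₗ[ℂ] V) v) ∂μ := by
    intro φ
    have h1 : ∀ g : G, φ ((ρ g : V ≃ₗ[ℂ] V) v) =
        ∑ i, β i ((ρ g : V ≃ₗ[ℂ] V) v) * φ (b i : V) := by
      intro g
      conv_lhs => rw [hsum _ (aut_mem_degree (ρ g) hv)]
      simp [map_sum]
    simp_rw [h1]
    rw [integral_finsetSum _ fun i _ => (hint (β i) v).mul_const _]
    simp [map_sum, integral_mul_const]
  refine ⟨∑ i, (∫ g, β i ((ρ g : V ≃ₗ[ℂ] V) v) ∂μ) • (b i : V),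
    Submodule.sum_mem _ fun i _ => Submodule.smul_mem _ _ (b i).2, fun k => ?_,
    fun φ hφ => ?_⟩
  -- Functionals separate points. Testing `ρ k w` with `φ` integrates `φ(ρ(kg) v)` over `g`, which
  -- left invariance of Haar measure identifies with `φ(w)`.
  · rw [← sub_eq_zero, ← Module.forall_dual_apply_eq_zero_iff ℂ]
    intro φ
    have h := key (φ ∘ₗ (ρ k : V ≃ₗ[ℂ] V).toLinearMap)
    simp only [LinearMap.comp_apply, LinearEquiv.coe_coe] at h
    rw [map_sub, h, key, sub_eq_zero,
      ← integral_mul_left_eq_self (fun g => φ ((ρ g : V ≃ₗ[ℂ] V) v)) k]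
    simp only [map_mul]
    rfl
  · rw [key]
    simp [hφ]

end average

end VOA

/-! ### The average is the projection -/

theorem theorem2p2 {V : Type u} [AddCommGroup V] [Module ℂ V] (𝒱 : VOA V) (D : 𝒱.Decomposition)
    (hD : D.IsNatural)
    {d : ℕ} {G : Type w} [Group G] [TopologicalSpace G] [ChartedSpace (EuclideanSpace ℝ (Fin d)) G]
    [LieGroup (𝓡 d) ∞ G] [CompactSpace G] [T2Space G]
    (ρ : G →* 𝒱.aut)
    (hρ : ∀ (φ : Module.Dual ℂ V) (v : V), Continuous fun g : G => φ ((ρ g : V ≃ₗ[ℂ] V) v))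
    {N : Type v} [AddCommGroup N] [Module ℂ N] (M : 𝒱.Mod N) (hM : M.IsInvariant.{u, v, w, x} ρ) (h : ℂ)
    (t : ℕ) (DG : (VOA.fixed ρ).Decomposition) (hμ : (t : ℕ∞) + 1 ≤ DG.minimalWeight) :
    M.IsConformalDesign D h t := by
  intro n hn v hv
  have : IsTopologicalGroup G := topologicalGroup_of_lieGroup (𝓡 d) ∞
  obtain ⟨w, hw, hfix, hφ⟩ := VOA.exists_average ρ hρ hv
  have hπw : D.π w = w := D.π_eq_self (by
    rw [D.isotypic_zero]
    exact VOA.coe_mem_virasoroSpan_vac_of_le_minimalWeight ρ DG hμ hn (v := ⟨w, hfix⟩) hw)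
  -- `φ ∘ π` is constant on the orbit of `v` for every functional `φ`, so `π(w) = π(v)`.
  have hwv : w = D.π v := by
    rw [← hπw, ← sub_eq_zero, ← Module.forall_dual_apply_eq_zero_iff ℂ]
    intro φ
    rw [map_sub, sub_eq_zero]
    exact hφ (φ ∘ₗ D.π) fun g => congrArg φ (hD.π_aut (ρ g) v)
  -- The trace is defined on `Vₙ` only, while the average is tested by functionals on all of `V`.
  obtain ⟨T, hT⟩ := LinearMap.exists_extend (M.traceZeroMode h n)
  have hT' : ∀ (y : V) (hy : y ∈ 𝒱.degree n),
      T y = LinearMap.trace ℂ (M.degree h) (M.zeroMode hy h) :=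
    fun y hy => LinearMap.congr_fun hT ⟨y, hy⟩
  rw [← hT', ← hT', ← hwv]
  refine (hφ T fun g => ?_).symm
  rw [hT' _ (VOA.aut_mem_degree (ρ g) hv), hT' _ hv, hM.trace_zeroMode h hv g]
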